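/- For integers $n, m \ge 0$ let $D^e_{2,2}(n,m)$ be the number of partitions of $n$ into exactly $m$ (positive) parts in which any two parts differ by at least $2$, and any two successive parts differ by at least $3$ unless both of them are even. For $k\ge 0$ put $(a;q)_k=\prod_{j=1}^{k}(1-aq^{j-1})$. Then, as an identity of formal power series in $q$ and $x$ with integer coefficients (the double sum on the right converging coefficientwise), $$\sum_{m,n\ge 0} D^e_{2,2}(n,m)\,q^n x^m=\sum_{n_1,n_2\ge 0}\frac{q^{4n_2^2+2n_2+(3n_1^2+n_1)/2+4n_2n_1}\,\bigl(1+xq^{4n_2+2n_1+1}\bigr)\,x^{2n_2+n_1}}{(q;q)_{n_1}\,(q^4;q^4)_{n_2}}.$$ -/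

import Mathlib

open scoped MvPowerSeries.WithPiTopology

/-- The condition on a partition `p` of `n`: listing the parts in weakly increasing order, any two
parts differ by at least two, and two successive parts differ by at least three unless both of
them are even. -/
def IsEvenGG {n : ℕ} (p : n.Partition) : Prop :=
  (p.parts.sort (· ≤ ·)).Pairwise (fun a b => a + 2 ≤ b) ∧
    (p.parts.sort (· ≤ ·)).IsChain (fun a b => ¬ (Even a ∧ Even b) → a + 3 ≤ b)

instance {n : ℕ} : DecidablePred (IsEvenGG (n := n)) := fun p => by
  unfold IsEvenGG
  infer_instance

/-- The number of partitions of `n` into `m` parts satisfying `IsEvenGG`. -/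
def De22 (n m : ℕ) : ℕ :=
  (Finset.univ.filter fun p : n.Partition => p.parts.card = m ∧ IsEvenGG p).card

/-- Formal power series with integer coefficients in the two variables `q` and `x`. -/
abbrev QXSeries : Type := MvPowerSeries (Fin 2) ℤ

/-- The variable `q`. -/
noncomputable def qVar : QXSeries := MvPowerSeries.X 0

/-- The variable `x`. -/
noncomputable def xVar : QXSeries := MvPowerSeries.X 1

/-- The series `∑ De22 n m * q ^ n * x ^ m`, i.e. the one whose coefficient at `q ^ n * x ^ m`
is `De22 n m`. -/
noncomputable def genDe22 : QXSeries := fun d => (De22 (d 0) (d 1) : ℤ)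

/-- The finite `q`-Pochhammer symbol `(a; q)_n = ∏_{j = 1}^{n} (1 - a q^{j-1})`. -/
def qPoch {R : Type*} [CommRing R] (a q : R) (n : ℕ) : R :=
  ∏ j ∈ Finset.range n, (1 - a * q ^ j)

/-- `(q^k; q^k)_n` is invertible for `k ≥ 1`, so that `Ring.inverse` is its true inverse. -/
theorem isUnit_qPoch (k n : ℕ) (hk : k ≠ 0) : IsUnit (qPoch (qVar ^ k) (qVar ^ k) n) := by
  rw [MvPowerSeries.isUnit_iff_constantCoeff]
  simp [qPoch, qVar, map_prod, hk]

/-- `genDe22` is the sum of all the terms `De22 n m * q ^ n * x ^ m`, in the topology of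
coefficientwise convergence (coefficients in the discrete space `ℤ`). -/
theorem hasSum_genDe22 :
    HasSum (fun p : ℕ × ℕ => (De22 p.1 p.2 : QXSeries) * qVar ^ p.1 * xVar ^ p.2) genDe22 := by
  let e : ℕ × ℕ ≃ (Fin 2 →₀ ℕ) :=
    (finTwoArrowEquiv ℕ).symm.trans Finsupp.equivFunOnFinite.symm
  have h := MvPowerSeries.WithPiTopology.hasSum_of_monomials_self (R := ℤ) genDe22
  rw [← e.hasSum_iff] at h
  convert h using 2 with p
  have h0 : e p 0 = p.1 := by simp [e, finTwoArrowEquiv]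
  have h1 : e p 1 = p.2 := by simp [e, finTwoArrowEquiv]
  have hs : e p = Finsupp.single 0 p.1 + Finsupp.single 1 p.2 := by
    ext i; fin_cases i <;> simp [h0, h1]
  have hc : MvPowerSeries.coeff (e p) genDe22 = (De22 p.1 p.2 : ℤ) := by
    change (De22 (e p 0) (e p 1) : ℤ) = _
    rw [h0, h1]
  simp only [Function.comp_apply]
  rw [hc, hs, qVar, xVar, MvPowerSeries.X_pow_eq, MvPowerSeries.X_pow_eq, mul_assoc,
    MvPowerSeries.monomial_mul_monomial]
  rw [show ((De22 p.1 p.2 : ℕ) : QXSeries) = MvPowerSeries.C ((De22 p.1 p.2 : ℕ) : ℤ) by simp]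
  rw [← MvPowerSeries.monomial_zero_eq_C_apply, MvPowerSeries.monomial_mul_monomial]
  simp

/-- The `(n₁, n₂)` summand
`q^{4n₂²+2n₂+(3n₁²+n₁)/2+4n₂n₁} (1 + x q^{4n₂+2n₁+1}) x^{2n₂+n₁} / ((q;q)_{n₁} (q⁴;q⁴)_{n₂})`.
The division by 2 in the exponent is exact, since `3n₁²+n₁` is even. -/
noncomputable def termDe22 (n₁ n₂ : ℕ) : QXSeries :=
  qVar ^ (4 * n₂ ^ 2 + 2 * n₂ + (3 * n₁ ^ 2 + n₁) / 2 + 4 * n₂ * n₁) *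
    (1 + xVar * qVar ^ (4 * n₂ + 2 * n₁ + 1)) * xVar ^ (2 * n₂ + n₁) *
    Ring.inverse (qPoch qVar qVar n₁ * qPoch (qVar ^ 4) (qVar ^ 4) n₂)

/-! Fix the number `m` of parts and let `G_k(m)` be `gapSeries k m`. Splitting on whether the least
part is `k`, for `k = 2, 3`, and using that adding 2 to every part preserves the conditions
(`gapSeries_add_two`) gives a first-order recursion for `G_2(m)` (`gapSeries_two_succ`). The sum of
`qTerm n₁ n₂` over `n₁ + 2 n₂ = m` obeys the same recursion up to powers of `x` (`weightSum_succ`),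
so the two agree (`gapSeries_two_eq`). Allowing a part 1 adds `x q^{2m+1} G_2(m)` in degree `m + 1`,
which is the factor `1 + x q^{4n₂+2n₁+1}`. -/

/-- The relation required between a part `a` and a later part `b`. -/
def Gap (a b : ℕ) : Prop := a + 2 ≤ b ∧ (¬ (Even a ∧ Even b) → a + 3 ≤ b)

theorem Gap.lt {a b : ℕ} (h : Gap a b) : a < b := by
  have := h.1
  omega

/-- Two differences of at least 2 add up to at least 4, so parity no longer matters. Hence the
condition on successive parts extends to all pairs. -/
instance : IsTrans ℕ Gap := ⟨fun a b c h₁ h₂ => by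
  have h₁ := h₁.1
  have h₂ := h₂.1
  exact ⟨by omega, fun _ => by omega⟩⟩

theorem gap_iff_of_even {a : ℕ} (ha : Even a) (b : ℕ) : Gap a b ↔ a + 2 ≤ b := by
  refine ⟨And.left, fun h => ⟨h, fun hne => ?_⟩⟩
  rcases h.eq_or_lt with rfl | h
  · exact absurd ⟨ha, ha.add even_two⟩ hne
  · exact h

theorem gap_iff_of_not_even {a : ℕ} (ha : ¬ Even a) (b : ℕ) : Gap a b ↔ a + 3 ≤ b :=
  ⟨fun h => h.2 fun h' => ha h'.1, fun h => ⟨by omega, fun _ => h⟩⟩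

theorem gap_add_two (a b : ℕ) : Gap (a + 2) (b + 2) ↔ Gap a b := by
  simp only [Gap, Nat.even_add, even_two, iff_true]
  constructor <;> rintro ⟨h₁, h₂⟩ <;>
    exact ⟨by omega, fun h => by have := h₂ h; omega⟩

theorem pairwise_gap_iff (l : List ℕ) :
    l.Pairwise Gap ↔ l.Pairwise (fun a b => a + 2 ≤ b) ∧
      l.IsChain (fun a b => ¬ (Even a ∧ Even b) → a + 3 ≤ b) := by
  constructor
  · intro h
    exact ⟨h.imp fun h => h.1, (h.imp fun h => h.2).isChain⟩
  · rintro ⟨h₁, h₂⟩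
    rw [← List.isChain_iff_pairwise]
    exact List.isChain_iff_getElem.2 fun i hi =>
      ⟨List.isChain_iff_getElem.1 h₁.isChain i hi, List.isChain_iff_getElem.1 h₂ i hi⟩

theorem isEvenGG_iff {n : ℕ} (p : n.Partition) :
    IsEvenGG p ↔ (p.parts.sort (· ≤ ·)).Pairwise Gap :=
  (pairwise_gap_iff _).symm

/-! ### Lists of parts with bounded least entry -/

/-- The lists of length `m` with sum `n` and entries at least `k`, any two of which satisfy
`Gap`. -/
def gapLists (k m n : ℕ) : Set (List ℕ) :=
  {l | l.length = m ∧ l.sum = n ∧ l.Pairwise Gap ∧ ∀ a ∈ l, k ≤ a}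

theorem finite_gapLists {k : ℕ} (hk : 0 < k) (m n : ℕ) : (gapLists k m n).Finite := by
  refine (Set.finite_range fun c : Composition n => c.blocks).subset ?_
  rintro l ⟨-, hs, -, hl⟩
  exact ⟨⟨l, fun {i} hi => hk.trans_le (hl i hi), hs⟩, rfl⟩

theorem De22_eq_ncard (n m : ℕ) : De22 n m = (gapLists 1 m n).ncard := by
  have himg : gapLists 1 m n = (fun p : n.Partition => p.parts.sort (· ≤ ·)) ''
      (Finset.univ.filter fun p : n.Partition => p.parts.card = m ∧ IsEvenGG p :
        Finset n.Partition) := by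
    ext l
    simp only [Set.mem_image, Finset.mem_coe, Finset.mem_filter, Finset.mem_univ, true_and,
      Set.mem_ofPred_eq, gapLists, isEvenGG_iff]
    constructor
    · rintro ⟨hm, hn, hl, hpos⟩
      have hsort : (l : Multiset ℕ).sort (· ≤ ·) = l := by
        rw [Multiset.coe_sort]
        exact List.mergeSort_of_pairwise (hl.imp fun h => by simpa using h.lt.le)
      refine ⟨⟨l, fun {i} hi => hpos i (by simpa using hi), by simpa using hn⟩, ⟨?_, ?_⟩, hsort⟩
      · simpa using hm
      · simpa only [hsort] using hl
    · rintro ⟨p, ⟨hm, hl⟩, rfl⟩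
      refine ⟨by simpa using hm, ?_, hl, fun a ha => p.parts_pos (by simpa using ha)⟩
      rw [← Multiset.sum_coe, Multiset.sort_eq, p.parts_sum]
  rw [himg, Set.ncard_image_of_injective, Set.ncard_coe_finset, De22]
  intro p p' h
  have := congrArg (fun l : List ℕ => (l : Multiset ℕ)) h
  simp only [Multiset.sort_eq] at this
  exact Nat.Partition.ext this

/-- Either `k` does not occur, or it is the head, and then the only constraint it puts on the tail
is the lower bound `k'`. -/
theorem gapLists_succ {k k' : ℕ} (h : ∀ b, Gap k b ↔ k' ≤ b) (hk : k < k') (m n : ℕ) :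
    gapLists k (m + 1) (n + k) =
      gapLists (k + 1) (m + 1) (n + k) ∪ List.cons k '' gapLists k' m n := by
  ext l
  simp only [gapLists, Set.mem_union, Set.mem_image, Set.mem_ofPred_eq]
  constructor
  · rintro ⟨hm, hn, hl, hb⟩
    cases l with
    | nil => simp at hm
    | cons a t =>
      rw [List.pairwise_cons] at hl
      simp only [List.length_cons, List.sum_cons, List.mem_cons, forall_eq_or_imp] at hm hn hb
      rcases hb.1.eq_or_lt with rfl | hlt
      · exact Or.inr ⟨t, ⟨by omega, by omega, hl.2, fun b hbt => (h b).1 (hl.1 b hbt)⟩, rfl⟩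
      · refine Or.inl ⟨by simpa using hm, by simpa using hn, List.pairwise_cons.2 hl, ?_⟩
        simp only [List.mem_cons, forall_eq_or_imp]
        exact ⟨hlt, fun b hbt => hlt.trans_le (hl.1 b hbt).lt.le⟩
  · rintro (⟨hm, hn, hl, hb⟩ | ⟨t, ⟨hm, hn, hl, hb⟩, rfl⟩)
    · exact ⟨hm, hn, hl, fun a ha => (Nat.le_succ k).trans (hb a ha)⟩
    · refine ⟨by simpa using hm, by simp [hn, add_comm], ?_, ?_⟩
      · exact List.pairwise_cons.2 ⟨fun b hbt => (h b).2 (hb b hbt), hl⟩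
      · simp only [List.mem_cons, forall_eq_or_imp]
        exact ⟨le_rfl, fun b hbt => hk.le.trans (hb b hbt)⟩

theorem ncard_gapLists_succ {k k' : ℕ} (h : ∀ b, Gap k b ↔ k' ≤ b) (hk : k < k') (m n : ℕ) :
    (gapLists k (m + 1) (n + k)).ncard =
      (gapLists (k + 1) (m + 1) (n + k)).ncard + (gapLists k' m n).ncard := by
  rw [gapLists_succ h hk, Set.ncard_union_eq _ (finite_gapLists k.succ_pos _ _)
    ((finite_gapLists (by omega) _ _).image _), Set.ncard_image_of_injective _
    List.cons_injective]
  rw [Set.disjoint_left]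
  rintro _ hl ⟨t, -, rfl⟩
  have := hl.2.2.2 k List.mem_cons_self
  omega

theorem gapLists_succ_of_lt {k n : ℕ} (hn : n < k) (m : ℕ) :
    gapLists k (m + 1) n = gapLists (k + 1) (m + 1) n := by
  have key : ∀ {j}, k ≤ j → gapLists j (m + 1) n = ∅ := fun {j} hj => by
    rw [Set.eq_empty_iff_forall_notMem]
    rintro (_ | ⟨a, t⟩) ⟨hm, hs, -, hb⟩
    · simp at hm
    · have := hb a List.mem_cons_self
      rw [List.sum_cons] at hs
      omega
  rw [key le_rfl, key k.le_succ]

theorem gapLists_add_two (k m n : ℕ) :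
    gapLists (k + 2) m (n + 2 * m) = List.map (· + 2) '' gapLists k m n := by
  ext l
  constructor
  · rintro ⟨hm, hn, hl, hb⟩
    have hmap : (l.map (· - 2)).map (· + 2) = l := by
      rw [List.map_map]
      conv_rhs => rw [← List.map_id l]
      exact List.map_congr_left fun a ha => by have := hb a ha; simp; omega
    rw [← hmap, List.pairwise_map] at hl
    simp only [gap_add_two] at hl
    refine ⟨l.map (· - 2), ⟨by simpa using hm, ?_, hl, ?_⟩, hmap⟩
    · rw [← hmap, List.sum_map_add] at hn
      simp only [List.map_id', List.map_const', List.length_map, List.sum_replicate,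
        smul_eq_mul, hm] at hn
      omega
    · simp only [List.mem_map, forall_exists_index, and_imp]
      rintro _ b hbl rfl
      have := hb b hbl
      omega
  · rintro ⟨l, ⟨hm, hn, hl, hb⟩, rfl⟩
    refine ⟨by simpa using hm, ?_, ?_, ?_⟩
    · rw [List.sum_map_add]
      simp [hn, hm, mul_comm]
    · rw [List.pairwise_map]
      simpa only [gap_add_two] using hl
    · simpa using hb

theorem gapLists_add_two_of_lt {n m : ℕ} (hn : n < 2 * m) (k : ℕ) :
    gapLists (k + 2) m n = ∅ := by
  rw [Set.eq_empty_iff_forall_notMem]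
  rintro l ⟨hm, hs, -, hb⟩
  have := List.card_nsmul_le_sum l 2 fun a ha => by have := hb a ha; omega
  rw [hm, hs, smul_eq_mul] at this
  omega

/-! ### Generating functions of the lists -/

/-- The generating function of the lists of length `m` with entries at least `k`, any two of which
satisfy `Gap`, including the factor `x ^ m`. -/
noncomputable def gapSeries (k m : ℕ) : QXSeries :=
  fun d => if d 1 = m then ((gapLists k m (d 0)).ncard : ℤ) else 0

theorem coeff_gapSeries (k m : ℕ) (d : Fin 2 →₀ ℕ) :
    MvPowerSeries.coeff d (gapSeries k m) =
      if d 1 = m then ((gapLists k m (d 0)).ncard : ℤ) else 0 := rfl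

theorem coeff_qVar_pow_mul (j : ℕ) (f : QXSeries) (d : Fin 2 →₀ ℕ) :
    MvPowerSeries.coeff d (qVar ^ j * f) =
      if j ≤ d 0 then MvPowerSeries.coeff (d - Finsupp.single 0 j) f else 0 := by
  rw [qVar, MvPowerSeries.X_pow_eq, MvPowerSeries.coeff_monomial_mul]
  simp [Finsupp.single_le_iff]

theorem coeff_xVar_pow_mul (j : ℕ) (f : QXSeries) (d : Fin 2 →₀ ℕ) :
    MvPowerSeries.coeff d (xVar ^ j * f) =
      if j ≤ d 1 then MvPowerSeries.coeff (d - Finsupp.single 1 j) f else 0 := by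
  rw [xVar, MvPowerSeries.X_pow_eq, MvPowerSeries.coeff_monomial_mul]
  simp [Finsupp.single_le_iff]

theorem coeff_xVar_mul (f : QXSeries) (d : Fin 2 →₀ ℕ) :
    MvPowerSeries.coeff d (xVar * f) =
      if 1 ≤ d 1 then MvPowerSeries.coeff (d - Finsupp.single 1 1) f else 0 := by
  simpa using coeff_xVar_pow_mul 1 f d

theorem gapSeries_succ {k k' : ℕ} (h : ∀ b, Gap k b ↔ k' ≤ b) (hk : k < k') (m : ℕ) :
    gapSeries k (m + 1) = gapSeries (k + 1) (m + 1) + xVar * (qVar ^ k * gapSeries k' m) := by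
  ext d
  rw [map_add, coeff_xVar_mul, coeff_qVar_pow_mul]
  simp only [coeff_gapSeries, Finsupp.coe_tsub, Pi.sub_apply, Finsupp.single_apply]
  by_cases hm : d 1 = m + 1
  · by_cases hn : k ≤ d 0
    · obtain ⟨n, hn'⟩ := Nat.exists_eq_add_of_le' hn
      simp [hm, hn', ncard_gapLists_succ h hk]
    · simp [hm, hn, gapLists_succ_of_lt (not_le.1 hn)]
  · have : 1 ≤ d 1 → d 1 - 1 ≠ m := by omega
    simp +contextual [hm, this]

theorem gapSeries_add_two (k m : ℕ) :
    gapSeries (k + 2) m = qVar ^ (2 * m) * gapSeries k m := by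
  ext d
  rw [coeff_qVar_pow_mul]
  simp only [coeff_gapSeries, Finsupp.coe_tsub, Pi.sub_apply, Finsupp.single_apply]
  by_cases hm : d 1 = m
  · by_cases hn : 2 * m ≤ d 0
    · obtain ⟨n, hn'⟩ := Nat.exists_eq_add_of_le' hn
      simp [hm, hn', gapLists_add_two, Set.ncard_image_of_injective _
        (List.map_injective_iff.2 (add_left_injective 2))]
    · simp [hm, hn, gapLists_add_two_of_lt (not_le.1 hn)]
  · simp [hm]

theorem gapSeries_zero (k : ℕ) : gapSeries k 0 = 1 := by
  have hcard (n : ℕ) : (gapLists k 0 n).ncard = if n = 0 then 1 else 0 := by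
    split_ifs with h
    · rw [Set.ncard_eq_one]
      refine ⟨[], Set.eq_singleton_iff_unique_mem.2 ⟨by simp [gapLists, h], fun l hl => ?_⟩⟩
      exact List.length_eq_zero_iff.1 hl.1
    · have : gapLists k 0 n = ∅ := by
        rw [Set.eq_empty_iff_forall_notMem]
        rintro l ⟨hl, hs, -⟩
        rw [List.length_eq_zero_iff.1 hl] at hs
        exact h hs.symm
      simp [this]
  ext d
  rw [coeff_gapSeries, MvPowerSeries.coeff_one, hcard]
  have : d = 0 ↔ d 1 = 0 ∧ d 0 = 0 := by
    simp [Finsupp.ext_iff, Fin.forall_fin_two, and_comm]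
  simp only [this, ite_and]
  split_ifs <;> rfl

/-- Remove a least part 2 (the rest is at least 4), then a least part 3 (the rest is at least 6).
What remains has parts at least 4, and shifts by 2 bring every term back to bound 2. -/
theorem gapSeries_two_succ (m : ℕ) :
    (1 - qVar ^ (2 * m + 2)) * gapSeries 2 (m + 1) =
      xVar * (qVar ^ (2 * m + 2) * (1 + qVar ^ (2 * m + 1)) * gapSeries 2 m) := by
  have h₂ := gapSeries_succ (fun b => gap_iff_of_even even_two b) (by omega) m
  have h₃ := gapSeries_succ (k := 3) (fun b => gap_iff_of_not_even (by decide) b) (by omega) m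
  have e₁ := gapSeries_add_two 2 (m + 1)
  have e₂ := gapSeries_add_two 2 m
  have e₃ := gapSeries_add_two 4 m
  norm_num at h₂ h₃ e₁ e₂ e₃
  rw [e₁, e₃, e₂] at h₃
  rw [h₃, e₂] at h₂
  linear_combination h₂

theorem genDe22_coeff (d : Fin 2 →₀ ℕ) :
    MvPowerSeries.coeff d genDe22 = MvPowerSeries.coeff d (gapSeries 1 (d 1)) := by
  rw [coeff_gapSeries, if_pos rfl, ← De22_eq_ncard]
  rfl

theorem gapSeries_one_succ (m : ℕ) :
    gapSeries 1 (m + 1) =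
      gapSeries 2 (m + 1) + xVar * (qVar ^ (2 * m + 1) * gapSeries 2 m) := by
  rw [gapSeries_succ (fun b => gap_iff_of_not_even (by decide) b) (by omega) m,
    gapSeries_add_two 2 m]
  ring

/-! ### The summands of the double series -/

/-- The series `q^{4n₂²+2n₂+(3n₁²+n₁)/2+4n₂n₁} / ((q;q)_{n₁} (q⁴;q⁴)_{n₂})`. -/
noncomputable def qTerm (n₁ n₂ : ℕ) : QXSeries :=
  qVar ^ (4 * n₂ ^ 2 + 2 * n₂ + (3 * n₁ ^ 2 + n₁) / 2 + 4 * n₂ * n₁) *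
    Ring.inverse (qPoch qVar qVar n₁ * qPoch (qVar ^ 4) (qVar ^ 4) n₂)

theorem termDe22_eq (n₁ n₂ : ℕ) :
    termDe22 n₁ n₂ = xVar ^ (n₁ + 2 * n₂) * qTerm n₁ n₂ +
      xVar * (qVar ^ (2 * (n₁ + 2 * n₂) + 1) * (xVar ^ (n₁ + 2 * n₂) * qTerm n₁ n₂)) := by
  rw [termDe22, qTerm]
  ring

theorem isUnit_denom (n₁ n₂ : ℕ) :
    IsUnit (qPoch qVar qVar n₁ * qPoch (qVar ^ 4) (qVar ^ 4) n₂) := by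
  simpa using (isUnit_qPoch 1 n₁ one_ne_zero).mul (isUnit_qPoch 4 n₂ (by norm_num))

theorem qTerm_mul_denom (n₁ n₂ : ℕ) :
    qTerm n₁ n₂ * (qPoch qVar qVar n₁ * qPoch (qVar ^ 4) (qVar ^ 4) n₂) =
      qVar ^ (4 * n₂ ^ 2 + 2 * n₂ + (3 * n₁ ^ 2 + n₁) / 2 + 4 * n₂ * n₁) := by
  rw [qTerm, mul_assoc, Ring.inverse_mul_cancel _ (isUnit_denom n₁ n₂), mul_one]

theorem qTerm_succ_left (n₁ n₂ : ℕ) :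
    (1 - qVar ^ (n₁ + 1)) * qTerm (n₁ + 1) n₂ =
      qVar ^ (3 * n₁ + 2 + 4 * n₂) * qTerm n₁ n₂ := by
  apply (isUnit_denom n₁ n₂).mul_right_cancel
  rw [mul_assoc (qVar ^ _), qTerm_mul_denom, ← pow_add]
  have h := qTerm_mul_denom (n₁ + 1) n₂
  rw [qPoch, Finset.prod_range_succ, ← qPoch] at h
  have he : 3 * n₁ + 2 + 4 * n₂ +
      (4 * n₂ ^ 2 + 2 * n₂ + (3 * n₁ ^ 2 + n₁) / 2 + 4 * n₂ * n₁) =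
      4 * n₂ ^ 2 + 2 * n₂ + (3 * (n₁ + 1) ^ 2 + (n₁ + 1)) / 2 + 4 * n₂ * (n₁ + 1) := by
    -- The increment is a multiple of 2, so it passes through the floor division.
    have : 3 * (n₁ + 1) ^ 2 + (n₁ + 1) = 3 * n₁ ^ 2 + n₁ + (3 * n₁ + 2) * 2 := by ring
    rw [this, Nat.add_mul_div_right _ _ two_pos]
    ring
  rw [he, ← h]
  ring

theorem qTerm_succ_right (n₁ n₂ : ℕ) :
    (1 - qVar ^ (4 * n₂ + 4)) * qTerm n₁ (n₂ + 1) =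
      qVar ^ (8 * n₂ + 6 + 4 * n₁) * qTerm n₁ n₂ := by
  apply (isUnit_denom n₁ n₂).mul_right_cancel
  rw [mul_assoc (qVar ^ _), qTerm_mul_denom, ← pow_add]
  have h := qTerm_mul_denom n₁ (n₂ + 1)
  rw [qPoch.eq_def (qVar ^ 4), Finset.prod_range_succ, ← qPoch] at h
  have he : 8 * n₂ + 6 + 4 * n₁ +
      (4 * n₂ ^ 2 + 2 * n₂ + (3 * n₁ ^ 2 + n₁) / 2 + 4 * n₂ * n₁) =
      4 * (n₂ + 1) ^ 2 + 2 * (n₂ + 1) + (3 * n₁ ^ 2 + n₁) / 2 + 4 * (n₂ + 1) * n₁ := by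
    ring
  rw [he, ← h]
  ring

/-! ### Sums of fixed weight `n₁ + 2 n₂` -/

/-- The pairs `(n₁, n₂)` with `n₁ + 2 n₂ = m`. -/
def weightPairs (m : ℕ) : Finset (ℕ × ℕ) :=
  (Finset.range (m + 1) ×ˢ Finset.range (m + 1)).filter fun p => p.1 + 2 * p.2 = m

theorem mem_weightPairs {m : ℕ} {p : ℕ × ℕ} : p ∈ weightPairs m ↔ p.1 + 2 * p.2 = m := by
  simp only [weightPairs, Finset.mem_filter, Finset.mem_product, Finset.mem_range]
  omega

theorem sum_weightPairs_succ {M : Type*} [AddCommMonoid M] (m : ℕ) (f : ℕ × ℕ → M)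
    (hf : ∀ n₂, f (0, n₂) = 0) :
    ∑ p ∈ weightPairs (m + 1), f p = ∑ p ∈ weightPairs m, f (p.1 + 1, p.2) := by
  symm
  apply Finset.sum_of_injOn (fun p => (p.1 + 1, p.2))
  · rintro ⟨a, b⟩ - ⟨c, d⟩ - h
    simpa using h
  · rintro ⟨a, b⟩ h
    simp only [Finset.mem_coe, mem_weightPairs] at h ⊢
    omega
  · rintro ⟨_ | a, b⟩ h h'
    · exact hf b
    · refine absurd ⟨(a, b), ?_, rfl⟩ h'
      simp only [Finset.mem_coe, mem_weightPairs] at h ⊢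
      omega
  · simp

theorem sum_weightPairs_add_two {M : Type*} [AddCommMonoid M] (m : ℕ) (f : ℕ × ℕ → M)
    (hf : ∀ n₁, f (n₁, 0) = 0) :
    ∑ p ∈ weightPairs (m + 2), f p = ∑ p ∈ weightPairs m, f (p.1, p.2 + 1) := by
  symm
  apply Finset.sum_of_injOn (fun p => (p.1, p.2 + 1))
  · rintro ⟨a, b⟩ - ⟨c, d⟩ - h
    simpa using h
  · rintro ⟨a, b⟩ h
    simp only [Finset.mem_coe, mem_weightPairs] at h ⊢
    omega
  · rintro ⟨a, _ | b⟩ h h'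
    · exact hf a
    · refine absurd ⟨(a, b), ?_, rfl⟩ h'
      simp only [Finset.mem_coe, mem_weightPairs] at h ⊢
      omega
  · simp

/-- The sum of `q^{b n₁ + c n₂}` times `qTerm n₁ n₂` over the pairs with `n₁ + 2 n₂ = m`. -/
noncomputable def weightSum (m b c : ℕ) : QXSeries :=
  ∑ p ∈ weightPairs m, qVar ^ (b * p.1 + c * p.2) * qTerm p.1 p.2

/-- The difference brings out `1 - q^{n₁}`, which cancels the last factor of `(q;q)_{n₁}` and kills
the terms with `n₁ = 0`; then `n₁` is reindexed. `weightSum_add_two_sub` does the same with `1 -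
q^{4n₂}`. -/
theorem weightSum_succ_sub (m b c : ℕ) :
    weightSum (m + 1) b c - weightSum (m + 1) (b + 1) c =
      qVar ^ (b + 2) * weightSum m (b + 3) (c + 4) := by
  rw [weightSum, weightSum, ← Finset.sum_sub_distrib, sum_weightPairs_succ, weightSum,
    Finset.mul_sum]
  · refine Finset.sum_congr rfl fun p _ => ?_
    linear_combination qVar ^ (b * (p.1 + 1) + c * p.2) * qTerm_succ_left p.1 p.2
  · simp

theorem weightSum_add_two_sub (m b c : ℕ) :
    weightSum (m + 2) b c - weightSum (m + 2) b (c + 4) =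
      qVar ^ (c + 6) * weightSum m (b + 4) (c + 8) := by
  rw [weightSum, weightSum, ← Finset.sum_sub_distrib, sum_weightPairs_add_two, weightSum,
    Finset.mul_sum]
  · refine Finset.sum_congr rfl fun p _ => ?_
    linear_combination qVar ^ (b * p.1 + c * (p.2 + 1)) * qTerm_succ_right p.1 p.2
  · simp

theorem weightSum_zero (b c : ℕ) : weightSum 0 b c = 1 := by
  have : weightPairs 0 = {(0, 0)} := rfl
  simp [weightSum, this, qTerm, qPoch]

theorem weightSum_one_sub (b c c' : ℕ) : weightSum 1 b c = weightSum 1 b c' := by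
  have : weightPairs 1 = {(1, 0)} := rfl
  simp [weightSum, this]

theorem weightSum_add (m b c : ℕ) :
    weightSum m (b + 2) (c + 4) = qVar ^ (2 * m) * weightSum m b c := by
  rw [weightSum, weightSum, Finset.mul_sum]
  refine Finset.sum_congr rfl fun p hp => ?_
  rw [← mem_weightPairs.1 hp]
  ring

theorem weightSum_succ (m : ℕ) :
    (1 - qVar ^ (2 * m + 2)) * weightSum (m + 1) 0 0 =
      qVar ^ (2 * m + 2) * (1 + qVar ^ (2 * m + 1)) * weightSum m 0 0 := by
  have h₁ := weightSum_succ_sub m 0 4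
  have h₂ := weightSum_succ_sub m 1 4
  have h₃ := weightSum_add (m + 1) 0 0
  have h₄ := weightSum_add m 0 0
  have h₅ := weightSum_add m 2 4
  norm_num at h₁ h₂ h₃ h₄ h₅
  -- Write `W m b c` for `weightSum m b c`. Telescope along `(0,0), (0,4), (1,4), (2,4)`; for `m ≥
  -- 1` it remains to see `W m 2 4 - W m 3 8 = q^4 * W (m-1) 4 8`, by telescoping along `(2,4),
  -- (3,4), (3,8)`. The small cases are separate because lowering `n₂` costs weight 2.
  have key : weightSum (m + 1) 0 0 - weightSum (m + 1) 2 4 =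
      qVar ^ 2 * weightSum m 2 4 + qVar ^ 3 * weightSum m 4 8 := by
    rcases m with _ | _ | m
    · have h₆ := weightSum_one_sub 0 0 4
      simp only [zero_add, weightSum_zero] at h₁ h₂ h₆ ⊢
      linear_combination h₁ + h₂ + h₆
    · have h₆ := weightSum_add_two_sub 0 0 0
      have h₇ := weightSum_succ_sub 0 2 4
      have h₈ := weightSum_one_sub 3 4 8
      norm_num [weightSum_zero] at h₁ h₂ h₆ h₇ h₈ ⊢
      linear_combination h₁ + h₂ + h₆ - qVar ^ 2 * h₇ - qVar ^ 2 * h₈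
    · have h₆ := weightSum_add_two_sub (m + 1) 0 0
      have h₇ := weightSum_succ_sub (m + 1) 2 4
      have h₈ := weightSum_add_two_sub m 3 4
      have h₉ := weightSum_succ_sub m 4 8
      norm_num [add_assoc] at h₁ h₂ h₆ h₇ h₈ h₉ ⊢
      linear_combination h₁ + h₂ + h₆ - qVar ^ 2 * h₇ - qVar ^ 2 * h₈ + qVar ^ 6 * h₉
  rw [h₃, h₅, h₄] at key
  linear_combination key

/-! ### Comparison and summation -/

theorem gapSeries_two_eq (m : ℕ) : gapSeries 2 m = xVar ^ m * weightSum m 0 0 := by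
  induction m with
  | zero => simp [gapSeries_zero, weightSum_zero]
  | succ m ih =>
    have hu : IsUnit (1 - qVar ^ (2 * m + 2)) := by
      rw [MvPowerSeries.isUnit_iff_constantCoeff]
      simp [qVar]
    apply hu.mul_left_cancel
    rw [gapSeries_two_succ, ih]
    linear_combination -xVar ^ (m + 1) * weightSum_succ m

theorem sum_termDe22 (m : ℕ) :
    ∑ p ∈ weightPairs m, termDe22 p.1 p.2 =
      gapSeries 2 m + xVar * (qVar ^ (2 * m + 1) * gapSeries 2 m) := by
  rw [gapSeries_two_eq, weightSum]
  simp only [Finset.mul_sum, ← Finset.sum_add_distrib]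
  refine Finset.sum_congr rfl fun p hp => ?_
  rw [termDe22_eq, mem_weightPairs.1 hp]
  simp

/-- Weight `m` only reaches `x`-degrees `m` and `m + 1`; the explicit conditionals let the sum over
`m` collapse. -/
theorem coeff_sum_termDe22 (m : ℕ) (d : Fin 2 →₀ ℕ) :
    MvPowerSeries.coeff d (∑ p ∈ weightPairs m, termDe22 p.1 p.2) =
      (if d 1 = m then MvPowerSeries.coeff d (gapSeries 2 m) else 0) +
      if d 1 = m + 1 then
        MvPowerSeries.coeff d (xVar * (qVar ^ (2 * m + 1) * gapSeries 2 m)) else 0 := by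
  rw [sum_termDe22, map_add]
  congr 1
  · split_ifs with h
    · rfl
    · rw [coeff_gapSeries, if_neg h]
  · split_ifs with h
    · rfl
    · rw [coeff_xVar_mul, coeff_qVar_pow_mul]
      have : 1 ≤ d 1 → d 1 - 1 ≠ m := by omega
      simp +contextual [coeff_gapSeries, this]

theorem coeff_termDe22_of_lt {d : Fin 2 →₀ ℕ} {n₁ n₂ : ℕ} (h : d 1 < n₁ + 2 * n₂) :
    MvPowerSeries.coeff d (termDe22 n₁ n₂) = 0 := by
  have : termDe22 n₁ n₂ = xVar ^ (n₁ + 2 * n₂) *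
      (qTerm n₁ n₂ + xVar * qVar ^ (2 * (n₁ + 2 * n₂) + 1) * qTerm n₁ n₂) := by
    rw [termDe22_eq]
    ring
  rw [this, coeff_xVar_pow_mul, if_neg (not_le.2 h)]

theorem coeff_genDe22_eq_sum (d : Fin 2 →₀ ℕ) :
    ∑ m ∈ Finset.range (d 1 + 1),
      MvPowerSeries.coeff d (∑ p ∈ weightPairs m, termDe22 p.1 p.2) =
      MvPowerSeries.coeff d genDe22 := by
  simp only [coeff_sum_termDe22, Finset.sum_add_distrib, genDe22_coeff]
  rw [Finset.sum_ite_eq, if_pos (Finset.self_mem_range_succ _)]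
  rcases hd : d 1 with _ | m
  · simp [gapSeries_zero]
  · simp only [Nat.add_right_cancel_iff]
    rw [Finset.sum_ite_eq, if_pos (by simp), ← map_add, gapSeries_one_succ]

theorem mainTheorem9 :
    HasSum (fun n : ℕ × ℕ => termDe22 n.1 n.2) genDe22 := by
  rw [MvPowerSeries.WithPiTopology.hasSum_iff_hasSum_coeff]
  intro d
  have hdisj : (Finset.range (d 1 + 1) : Set ℕ).PairwiseDisjoint weightPairs := by
    intro i _ j _ hij
    rw [Function.onFun, Finset.disjoint_left]
    intro p hi hj
    exact hij ((mem_weightPairs.1 hi).symm.trans (mem_weightPairs.1 hj))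
  rw [← coeff_genDe22_eq_sum]
  simp only [map_sum]
  rw [← Finset.sum_biUnion hdisj]
  -- Weights above `d 1` contribute nothing, so each coefficient is a finite sum.
  refine hasSum_sum_of_ne_finset_zero fun p hp => coeff_termDe22_of_lt ?_
  by_contra hlt
  refine hp (Finset.mem_biUnion.2 ⟨p.1 + 2 * p.2, ?_, mem_weightPairs.2 rfl⟩)
  rw [Finset.mem_range]
  omega
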